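/- Let $F$ be an algebraically closed field of characteristic $0$, let $G$ be a finite additive abelian group and let $\beta:G\times G\to F^\times$ be an alternating bicharacter, i.e. $\beta$ is multiplicative in each variable and $\beta(g,g)=1$ for all $g\in G$. Let $(G,\beta,R)$ be a skew root system of Jordan type, i.e. $R$ is a non-empty subset of $G$ such that $R$ generates $G$; $-a\in R$ for every $a\in R$; and $a+b\in R$ for all $a,b\in R$ with $\beta(a,b)\neq -1$. There is a 2-cocycle $\xi:G\times G\to F^\times$ (for the trivial action) with $\xi(a,b)\,\xi(b,a)^{-1}=\beta(a,b)$ for all $a,b\in G$. Fix any such $\xi$, let $F^{\xi}G$ be the twisted group algebra with basis $\{u_g\mid g\in G\}$ and multiplication $u_a u_b=\xi(a,b)\,u_{a+b}$, and let $$J(R)=\bigoplus_{a\in R}F u_a\subseteq F^\xi G,\qquad x\circ y=\tfrac12(xy+yx),$$ which is closed under $\circ$ and contains the identity of $F^\xi G$. Then: 1. $J(R)$ is a unital Jordan algebra, and the form $\tau(u,v)=\operatorname{tr} L(u\circ v)$ on $J(R)$, where $L(w)$ denotes the multiplication by $w$ on $J(R)$, is nondegenerate. 2. $J(R)$ is semisimple: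 it is finite-dimensional and its radical (the sum of all ideals consisting of nilpotent elements) is zero; moreover it is the direct sum of finitely many ideals that are simple algebras. 3. With $J(R)_g=Fu_g$ for $g\in R$ and $J(R)_g=0$ for $g\notin R$, the decomposition $J(R)=\bigoplus_{g\in G}J(R)_g$ is a $G$-grading with support $R$. It is multiplicity free (each non-zero component is one-dimensional) and it is a division grading: each non-zero homogeneous element $x$ is invertible in $J(R)$, i.e. there is $y\in J(R)$ with $x\circ y=1$ and $(x\circ x)\circ y=x$. In particular each $u_g$, $g\in R$, is invertible in $J(R)$. -/

import Mathlib

open scoped DirectSum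

noncomputable section

namespace SkewRoot

/-! ### Symplectic abelian groups and skew root systems of Jordan type -/

/-- An alternating bicharacter on the additive abelian group `G` with values in `Fˣ`. -/
structure AlternatingBicharacter (F G : Type*) [Field F] [AddCommGroup G] where
  toFun : G → G → Fˣ
  map_add_left : ∀ a b c, toFun (a + b) c = toFun a c * toFun b c
  map_add_right : ∀ a b c, toFun a (b + c) = toFun a b * toFun a c
  map_self : ∀ a, toFun a a = 1

instance {F G : Type*} [Field F] [AddCommGroup G] :
    CoeFun (AlternatingBicharacter F G) (fun _ => G → G → Fˣ) := ⟨AlternatingBicharacter.toFun⟩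

/-- `(G, β, R)` is a skew root system of Jordan type. -/
structure IsJordanSystem {F G : Type*} [Field F] [AddCommGroup G]
    (β : AlternatingBicharacter F G) (R : Set G) : Prop where
  nonempty : R.Nonempty
  generates : AddSubgroup.closure R = ⊤
  neg_mem : ∀ a ∈ R, -a ∈ R
  add_mem : ∀ a ∈ R, ∀ b ∈ R, β a b ≠ -1 → a + b ∈ R

theorem IsJordanSystem.zero_mem {F G : Type*} [Field F] [CharZero F] [AddCommGroup G]
    {β : AlternatingBicharacter F G} {R : Set G} (h : IsJordanSystem β R) : (0 : G) ∈ R := by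
  obtain ⟨a, ha⟩ := h.nonempty
  have h0 : β a 0 = 1 := by
    have := β.map_add_right a 0 0
    rw [add_zero] at this
    exact left_eq_mul.mp this
  have h1 : β a (-a) = 1 := by
    have := β.map_add_right a a (-a)
    rw [add_neg_cancel, h0, β.map_self, one_mul] at this
    exact this.symm
  have h2 := h.add_mem a ha (-a) (h.neg_mem a ha) (by
    rw [h1]
    intro h3
    have h4 : (1 : F) = -1 := by simpa using congrArg Units.val h3
    have h5 : (2 : F) = 0 := by linear_combination h4
    exact two_ne_zero h5)
  simpa using h2

/-! ### Twisted group algebras -/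

/-- A 2-cocycle of `G` with values in `Fˣ` (trivial action). -/
structure TwoCocycle (F G : Type*) [Field F] [AddCommGroup G] where
  toFun : G → G → Fˣ
  cocycle : ∀ a b c, toFun a b * toFun (a + b) c = toFun b c * toFun a (b + c)

instance {F G : Type*} [Field F] [AddCommGroup G] :
    CoeFun (TwoCocycle F G) (fun _ => G → G → Fˣ) := ⟨TwoCocycle.toFun⟩

namespace TwoCocycle

variable {F G : Type*} [Field F] [AddCommGroup G]

/-- The 2-cocycle `ξ` corresponds to `β`, i.e. `Ψ(ξ) = β`. -/
def CorrespondsTo (ξ : TwoCocycle F G) (β : AlternatingBicharacter F G) : Prop :=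
  ∀ a b, β a b = ξ a b * (ξ b a)⁻¹

theorem zero_left (ξ : TwoCocycle F G) (c : G) : ξ 0 c = ξ 0 0 := by
  have := ξ.cocycle 0 0 c
  simp only [zero_add] at this
  exact (mul_right_cancel this).symm

theorem zero_right (ξ : TwoCocycle F G) (a : G) : ξ a 0 = ξ 0 0 := by
  have := ξ.cocycle a 0 0
  simp only [add_zero] at this
  exact mul_right_cancel this

end TwoCocycle

/-- The twisted group algebra `F^ξ G`: the vector space with basis `(u_g)`, `g ∈ G`, and the
multiplication `u_a u_b = ξ(a, b) u_{a+b}`. -/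
def TwistedGroupAlgebra {F G : Type*} [Field F] [AddCommGroup G] (_ξ : TwoCocycle F G) : Type _ :=
  G →₀ F

namespace TwistedGroupAlgebra

variable {F G : Type*} [Field F] [AddCommGroup G] (ξ : TwoCocycle F G)

instance : AddCommGroup (TwistedGroupAlgebra ξ) := inferInstanceAs (AddCommGroup (G →₀ F))

instance : Module F (TwistedGroupAlgebra ξ) := inferInstanceAs (Module F (G →₀ F))

/-- The basis `(u_g)`, `g ∈ G`, of `F^ξ G`. -/
def basis : Module.Basis G F (TwistedGroupAlgebra ξ) :=
  Module.Basis.ofRepr (LinearEquiv.refl F (G →₀ F))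

/-- The basis element `u_g`. -/
def u (g : G) : TwistedGroupAlgebra ξ := basis ξ g

/-- The bilinear multiplication determined by `u_a u_b = ξ(a, b) u_{a+b}`. -/
def mulMap : TwistedGroupAlgebra ξ →ₗ[F] TwistedGroupAlgebra ξ →ₗ[F] TwistedGroupAlgebra ξ :=
  (basis ξ).constr F fun a => (basis ξ).constr F fun b => (ξ a b : F) • u ξ (a + b)

theorem mulMap_u (a b : G) : mulMap ξ (u ξ a) (u ξ b) = (ξ a b : F) • u ξ (a + b) := by
  simp [mulMap, u]

/-- The identity `ξ(0,0)⁻¹ u_0` of `F^ξ G`. -/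
def unit : TwistedGroupAlgebra ξ := ((ξ 0 0)⁻¹ : F) • u ξ 0

theorem mulMap_assoc (x y z : TwistedGroupAlgebra ξ) :
    mulMap ξ (mulMap ξ x y) z = mulMap ξ x (mulMap ξ y z) := by
  have h : (mulMap ξ).compr₂ (mulMap ξ) =
      ((LinearMap.llcomp F (TwistedGroupAlgebra ξ) (TwistedGroupAlgebra ξ)
        (TwistedGroupAlgebra ξ)).comp (mulMap ξ)).compl₂ (mulMap ξ) := by
    refine (basis ξ).ext fun a => (basis ξ).ext fun b => (basis ξ).ext fun c => ?_
    change mulMap ξ (mulMap ξ (u ξ a) (u ξ b)) (u ξ c) =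
      mulMap ξ (u ξ a) (mulMap ξ (u ξ b) (u ξ c))
    simp only [mulMap_u, map_smul, LinearMap.smul_apply, smul_smul, add_assoc]
    congr 1
    exact_mod_cast congrArg Units.val (ξ.cocycle a b c)
  exact LinearMap.congr_fun (LinearMap.congr_fun (LinearMap.congr_fun h x) y) z

theorem unit_mulMap (x : TwistedGroupAlgebra ξ) : mulMap ξ (unit ξ) x = x := by
  have h : mulMap ξ (unit ξ) = LinearMap.id := by
    refine (basis ξ).ext fun a => ?_
    change mulMap ξ (unit ξ) (u ξ a) = u ξ a
    simp [unit, mulMap_u, smul_smul, ξ.zero_left a]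
  rw [h, LinearMap.id_apply]

theorem mulMap_unit (x : TwistedGroupAlgebra ξ) : mulMap ξ x (unit ξ) = x := by
  have h : (mulMap ξ).flip (unit ξ) = LinearMap.id := by
    refine (basis ξ).ext fun a => ?_
    change mulMap ξ (u ξ a) (unit ξ) = u ξ a
    simp [unit, mulMap_u, smul_smul, ξ.zero_right a]
  exact LinearMap.congr_fun h x

instance : Ring (TwistedGroupAlgebra ξ) :=
  { (inferInstance : AddCommGroup (TwistedGroupAlgebra ξ)) with
    mul := fun x y => mulMap ξ x y
    one := unit ξ
    left_distrib := fun x y z => map_add (mulMap ξ x) y z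
    right_distrib := fun x y z => by
      change mulMap ξ (x + y) z = mulMap ξ x z + mulMap ξ y z
      rw [map_add, LinearMap.add_apply]
    zero_mul := fun x => by
      change mulMap ξ 0 x = 0
      rw [map_zero, LinearMap.zero_apply]
    mul_zero := fun x => map_zero (mulMap ξ x)
    mul_assoc := mulMap_assoc ξ
    one_mul := unit_mulMap ξ
    mul_one := mulMap_unit ξ }

theorem mul_eq_mulMap (x y : TwistedGroupAlgebra ξ) : x * y = mulMap ξ x y := rfl

theorem one_eq_unit : (1 : TwistedGroupAlgebra ξ) = unit ξ := rfl

theorem u_mul_u (a b : G) : u ξ a * u ξ b = (ξ a b : F) • u ξ (a + b) := mulMap_u ξ a b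

instance : Algebra F (TwistedGroupAlgebra ξ) :=
  Algebra.ofModule
    (fun r x y => by rw [mul_eq_mulMap, mul_eq_mulMap, map_smul, LinearMap.smul_apply])
    (fun r x y => by rw [mul_eq_mulMap, mul_eq_mulMap, map_smul])

instance [CharZero F] : Invertible (2 : TwistedGroupAlgebra ξ) :=
  letI : Invertible (2 : F) := invertibleOfNonzero two_ne_zero
  (Invertible.map (algebraMap F (TwistedGroupAlgebra ξ)) 2).copy 2 (map_ofNat _ 2).symm

end TwistedGroupAlgebra

/-! ### The Jordan algebra `A⁺` is Mathlib's `Aˢʸᵐ`, with the product `½ (ab + ba)` -/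

section SymAlgInstances

variable {F A : Type*} [Field F] [Ring A] [Algebra F A] [Invertible (2 : A)]

instance : IsScalarTower F Aˢʸᵐ Aˢʸᵐ := ⟨fun r x y => by
  apply SymAlg.unsym_injective
  simp only [smul_eq_mul, SymAlg.unsym_smul, SymAlg.unsym_mul, smul_mul_assoc, mul_smul_comm,
    ← smul_add]⟩

instance : SMulCommClass F Aˢʸᵐ Aˢʸᵐ := ⟨fun r x y => by
  apply SymAlg.unsym_injective
  simp only [smul_eq_mul, SymAlg.unsym_smul, SymAlg.unsym_mul, smul_mul_assoc, mul_smul_comm,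
    ← smul_add]⟩

end SymAlgInstances

/-! ### The Jordan algebra `J(R)` -/

section JordanAlgebra

variable {F G : Type*} [Field F] [CharZero F] [AddCommGroup G]

theorem sym_u_mul_sym_u (ξ : TwoCocycle F G) (a b : G) :
    SymAlg.sym (TwistedGroupAlgebra.u ξ a) * SymAlg.sym (TwistedGroupAlgebra.u ξ b) =
      ((2 : F)⁻¹ * (ξ a b + ξ b a)) • SymAlg.sym (TwistedGroupAlgebra.u ξ (a + b)) := by
  rw [SymAlg.sym_mul_sym, TwistedGroupAlgebra.u_mul_u, TwistedGroupAlgebra.u_mul_u, add_comm b a,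
    ← add_smul, mul_smul_comm, mul_comm, mul_smul, ← SymAlg.sym_smul, ← SymAlg.sym_smul]
  congr 2
  rw [invOf_mul_eq_iff_eq_mul_left, ← map_ofNat (algebraMap F (TwistedGroupAlgebra ξ)) 2,
    ← Algebra.smul_def, smul_smul, mul_inv_cancel₀ two_ne_zero, one_smul]

/-- The Jordan algebra `J(R) = ⨁_{a ∈ R} F u_a`, a subalgebra of `(F^ξ G)⁺`. -/
def jordanSubalgebra (ξ : TwoCocycle F G) {β : AlternatingBicharacter F G}
    (hξ : ξ.CorrespondsTo β) {R : Set G} (hR : IsJordanSystem β R) :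
    NonUnitalSubalgebra F (TwistedGroupAlgebra ξ)ˢʸᵐ :=
  { Submodule.span F ((fun a => SymAlg.sym (TwistedGroupAlgebra.u ξ a)) '' R) with
    mul_mem' := by
      intro x y hx hy
      change x * y ∈ Submodule.span F ((fun a => SymAlg.sym (TwistedGroupAlgebra.u ξ a)) '' R)
      refine Submodule.span_induction₂ (p := fun x y _ _ => x * y ∈
        Submodule.span F ((fun a => SymAlg.sym (TwistedGroupAlgebra.u ξ a)) '' R))
        ?_ ?_ ?_ ?_ ?_ ?_ ?_ hx hy
      · rintro _ _ ⟨a, ha, rfl⟩ ⟨b, hb, rfl⟩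
        change SymAlg.sym (TwistedGroupAlgebra.u ξ a) * SymAlg.sym (TwistedGroupAlgebra.u ξ b) ∈ _
        rw [sym_u_mul_sym_u]
        by_cases h : β a b = -1
        · have h1 : (ξ a b : F) + ξ b a = 0 := by
            have h2 := hξ a b
            rw [h, eq_mul_inv_iff_mul_eq] at h2
            have h3 := congrArg Units.val h2
            simp only [neg_mul, one_mul, Units.val_neg] at h3
            rw [← h3, neg_add_cancel]
          rw [h1, mul_zero, zero_smul]
          exact Submodule.zero_mem _
        · exact Submodule.smul_mem _ _
            (Submodule.subset_span ⟨a + b, hR.add_mem a ha b hb h, rfl⟩)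
      · intro y _
        rw [zero_mul]
        exact Submodule.zero_mem _
      · intro x _
        rw [mul_zero]
        exact Submodule.zero_mem _
      · intro x y z _ _ _ h1 h2
        rw [add_mul]
        exact Submodule.add_mem _ h1 h2
      · intro x y z _ _ _ h1 h2
        rw [mul_add]
        exact Submodule.add_mem _ h1 h2
      · intro r x y _ _ h
        rw [smul_mul_assoc]
        exact Submodule.smul_mem _ r h
      · intro r x y _ _ h
        rw [mul_smul_comm]
        exact Submodule.smul_mem _ r h }

variable (ξ : TwoCocycle F G) {β : AlternatingBicharacter F G}
  (hξ : ξ.CorrespondsTo β) {R : Set G} (hR : IsJordanSystem β R)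

theorem u_mem {g : G} (hg : g ∈ R) :
    SymAlg.sym (TwistedGroupAlgebra.u ξ g) ∈ jordanSubalgebra ξ hξ hR :=
  Submodule.subset_span ⟨g, hg, rfl⟩

theorem one_mem : (1 : (TwistedGroupAlgebra ξ)ˢʸᵐ) ∈ jordanSubalgebra ξ hξ hR := by
  rw [← SymAlg.sym_one, TwistedGroupAlgebra.one_eq_unit, TwistedGroupAlgebra.unit, SymAlg.sym_smul]
  exact (jordanSubalgebra ξ hξ hR).toSubmodule.smul_mem _ (u_mem ξ hξ hR hR.zero_mem)

/-- `J(R)` as a type. -/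
abbrev JordanAlgebra : Type _ := ↥(jordanSubalgebra ξ hξ hR)

/-- `J(R)` contains the identity of `(F^ξ G)⁺`. -/
instance : NonAssocRing (JordanAlgebra ξ hξ hR) :=
  { (inferInstance : NonUnitalNonAssocRing (JordanAlgebra ξ hξ hR)) with
    one := ⟨1, one_mem ξ hξ hR⟩
    one_mul := fun x => Subtype.ext (one_mul x.1)
    mul_one := fun x => Subtype.ext (mul_one x.1) }

instance : CommMagma (JordanAlgebra ξ hξ hR) where
  mul_comm x y := Subtype.ext (SymAlg.mul_comm x.1 y.1)

/-- The element `u_g` of `J(R)`, for `g ∈ R`. -/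
def uJ {g : G} (hg : g ∈ R) : JordanAlgebra ξ hξ hR :=
  ⟨SymAlg.sym (TwistedGroupAlgebra.u ξ g), u_mem ξ hξ hR hg⟩

/-- The component of degree `g` of `J(R)`: the elements of `J(R)` in the line `F u_g`. -/
def component (g : G) : Submodule F (JordanAlgebra ξ hξ hR) :=
  (Submodule.span F {SymAlg.sym (TwistedGroupAlgebra.u ξ g)}).comap
    (jordanSubalgebra ξ hξ hR).toSubmodule.subtype

end JordanAlgebra

/-! ### Semisimplicity of nonassociative algebras -/

section Semisimple

variable {F J : Type*} [Field F] [NonUnitalNonAssocRing J] [Module F J]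

/-- Two-sided ideals of an `F`-algebra. -/
def IsIdeal (I : Submodule F J) : Prop :=
  ∀ a : J, ∀ x ∈ I, a * x ∈ I ∧ x * a ∈ I

/-- `x ^ (n + 1) = 0` for some `n`, where `x ^ (n + 1) = x * x ^ n`. -/
def IsNilElement (x : J) : Prop := ∃ n : ℕ, (fun y => x * y)^[n] x = 0

variable (F J) in
/-- The (nil) radical: the sum of all the ideals that consist of nilpotent elements. -/
def nilRadical : Submodule F J :=
  sSup {I : Submodule F J | IsIdeal I ∧ ∀ x ∈ I, IsNilElement x}

variable (F J) in
/-- A finite-dimensional algebra is semisimple if its radical vanishes. -/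
def IsSemisimple : Prop := FiniteDimensional F J ∧ nilRadical F J = ⊥

/-- `I` is an ideal which is a simple algebra: its product is not identically zero, and
its only ideals are `0` and `I`. -/
def IsSimpleIdeal (I : Submodule F J) : Prop :=
  IsIdeal I ∧ (∃ x ∈ I, ∃ y ∈ I, x * y ≠ 0) ∧
    ∀ K : Submodule F J, K ≤ I → (∀ a ∈ I, ∀ x ∈ K, a * x ∈ K ∧ x * a ∈ K) → K = ⊥ ∨ K = I

variable (F J) in
/-- The algebra is a (finite) direct sum of ideals which are simple algebras. -/
def IsDirectSumOfSimpleIdeals : Prop :=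
  ∃ (n : ℕ) (I : Fin n → Submodule F J), (∀ i, IsSimpleIdeal (I i)) ∧ DirectSum.IsInternal I

variable (F J) in
/-- The bilinear form `τ(x, y) = tr L(x ∘ y)`, where `L(z)` is multiplication by `z`. -/
def traceForm [IsScalarTower F J J] [SMulCommClass F J J] : LinearMap.BilinForm F J :=
  (LinearMap.mul F J).compr₂ ((LinearMap.trace F J).comp (LinearMap.mul F J))

end Semisimple

/-! ### Gradings -/

section Gradings

variable {F G J : Type*} [Field F] [AddCommGroup G]

open Classical in
/-- The family `𝒜` is a `G`-grading on the algebra `J`, whose support generates `G`. -/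
structure IsGrading [NonUnitalNonAssocRing J] [Module F J] (𝒜 : G → Submodule F J) : Prop where
  internal : DirectSum.IsInternal 𝒜
  mul_mem : ∀ g h, ∀ x ∈ 𝒜 g, ∀ y ∈ 𝒜 h, x * y ∈ 𝒜 (g + h)
  support_generates : AddSubgroup.closure {g | 𝒜 g ≠ ⊥} = ⊤

/-- Every (nonzero) homogeneous component is one-dimensional. -/
def IsMultiplicityFree [AddCommGroup J] [Module F J] (𝒜 : G → Submodule F J) : Prop :=
  ∀ g, 𝒜 g ≠ ⊥ → Module.finrank F (𝒜 g) = 1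

/-- `y` is a Jordan inverse of `x`: `x ∘ y = 1` and `x² ∘ y = x`. -/
def IsJordanInverse [NonAssocRing J] (x y : J) : Prop :=
  x * y = 1 ∧ (x * x) * y = x

/-- `x` is invertible in the Jordan algebra `J`. -/
def IsJordanInvertible [NonAssocRing J] (x : J) : Prop := ∃ y, IsJordanInverse x y

/-- Every nonzero homogeneous element is invertible. -/
def IsDivisionGrading [NonAssocRing J] [Module F J] (𝒜 : G → Submodule F J) : Prop :=
  ∀ g, ∀ x ∈ 𝒜 g, x ≠ 0 → IsJordanInvertible x

end Gradings

end SkewRoot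

end

/-! Everything rests on the functional t on the twisted group algebra that reads off the coefficient
at `u_0`. Since β(g, -g) = 1, the elements `u_g` and `u_{-g}` commute, so t(xy) = t(yx). In J(R),
multiplication by `u_a` moves the line of `u_b` to that of `u_{a+b}`, so it has no diagonal entries
unless a = 0, while `u_0` is ξ(0,0) times the identity. Hence τ(x, y) = |R| ξ(0,0) t(xy)
(`traceForm_apply`). This form is symmetric and associative, and it is nondegenerate because R = -R
makes `u_{-g}` dual to `u_g` up to nonzero scalars.

Jordan powers agree with associative powers, and in characteristic 0 the functional t vanishes on
nilpotent elements. A nil ideal is therefore τ-orthogonal to all of J(R), hence zero. Dieudonné's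
argument (`isDirectSumOfSimpleIdeals_of_form`) then splits J(R) into simple ideals. For the division
grading, `u_g` and a scalar multiple of `u_{-g}` are commuting associative inverses, hence Jordan
inverses.

The cocycle is the strictly upper triangular half of β with respect to a decomposition of G into
cyclic groups. -/

namespace SkewRoot

/-! ### Bicharacters and the existence of a cocycle. -/

section CocycleExistence

variable {F G : Type*} [Field F] [AddCommGroup G]

namespace AlternatingBicharacter

variable (β : AlternatingBicharacter F G)

/-- The character `β(·, b)`, written additively. -/
def leftHom (b : G) : G →+ Additive Fˣ :=
  AddMonoidHom.mk' (fun a => Additive.ofMul (β a b)) fun a c => by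
    rw [β.map_add_left, ofMul_mul]

/-- The character `β(a, ·)`, written additively. -/
def rightHom (a : G) : G →+ Additive Fˣ :=
  AddMonoidHom.mk' (fun b => Additive.ofMul (β a b)) fun b c => by
    rw [β.map_add_right, ofMul_mul]

theorem map_sum_left {ι : Type*} (s : Finset ι) (f : ι → G) (b : G) :
    β (∑ i ∈ s, f i) b = ∏ i ∈ s, β (f i) b :=
  map_sum (β.leftHom b) f s

theorem map_sum_right {ι : Type*} (s : Finset ι) (a : G) (f : ι → G) :
    β a (∑ i ∈ s, f i) = ∏ i ∈ s, β a (f i) :=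
  map_sum (β.rightHom a) f s

theorem map_zsmul_left (n : ℤ) (a b : G) : β (n • a) b = β a b ^ n :=
  map_zsmul (β.leftHom b) n a

theorem map_zsmul_right (n : ℤ) (a b : G) : β a (n • b) = β a b ^ n :=
  map_zsmul (β.rightHom a) n b

theorem map_neg_right (a b : G) : β a (-b) = (β a b)⁻¹ :=
  map_neg (β.rightHom a) b

theorem map_self_neg (a : G) : β a (-a) = 1 := by
  rw [β.map_neg_right, β.map_self, inv_one]

theorem inv_apply (a b : G) : (β a b)⁻¹ = β b a := by
  have h := β.map_self (a + b)
  rw [β.map_add_left, β.map_add_right, β.map_add_right, β.map_self, β.map_self, one_mul,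
    mul_one] at h
  exact inv_eq_of_mul_eq_one_right h

end AlternatingBicharacter

open Classical in
/-- Every alternating bicharacter of a finite abelian group comes from a 2-cocycle. -/
theorem exists_twoCocycle_correspondsTo [Finite G] (β : AlternatingBicharacter F G) :
    ∃ ξ : TwoCocycle F G, ξ.CorrespondsTo β := by
  obtain ⟨ι, _, n, -, ⟨e⟩⟩ := AddCommGroup.equiv_directSum_zmod_of_finite' G
  let o := Fintype.equivFin ι
  -- The projections onto the cyclic summands, viewed as endomorphisms of G.
  let π : ι → G →+ G := fun i => e.symm.toAddMonoidHom.comp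
    ((DirectSum.of (fun i => ZMod (n i)) i).comp
      ((DirectSum.component ℤ ι (fun i => ZMod (n i)) i).toAddMonoidHom.comp e.toAddMonoidHom))
  have hsum (a : G) : ∑ i, π i a = a := by
    apply e.injective
    rw [map_sum]
    simp only [π, AddMonoidHom.comp_apply, AddEquiv.toAddMonoidHom_eq_coe, AddMonoidHom.coe_coe,
      AddEquiv.apply_symm_apply]
    exact DirectSum.sum_univ_of (e a)
  have hcyc (i : ι) (a : G) : ∃ k : ℤ, π i a = k • e.symm (DirectSum.of _ i 1) := by
    refine ⟨(e a i).cast, ?_⟩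
    rw [← map_zsmul, ← map_zsmul, zsmul_one, ZMod.intCast_zmod_cast]
    rfl
  have hdiag (i : ι) (a b : G) : β (π i a) (π i b) = 1 := by
    obtain ⟨k, hk⟩ := hcyc i a
    obtain ⟨l, hl⟩ := hcyc i b
    rw [hk, hl, β.map_zsmul_left, β.map_zsmul_right, β.map_self, one_zpow, one_zpow]
  -- Half of β: the factors with i < j. The diagonal can be dropped since β is trivial on each
  -- cyclic summand. Bimultiplicativity gives the cocycle identity.
  let ξ : G → G → Fˣ := fun a b => ∏ i, ∏ j, if o i < o j then β (π i a) (π j b) else 1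
  have hl (a b c : G) : ξ (a + b) c = ξ a c * ξ b c := by
    simp only [ξ, ← Finset.prod_mul_distrib]
    refine Finset.prod_congr rfl fun i _ => Finset.prod_congr rfl fun j _ => ?_
    split_ifs
    · rw [map_add, β.map_add_left]
    · rw [one_mul]
  have hr (a b c : G) : ξ a (b + c) = ξ a b * ξ a c := by
    simp only [ξ, ← Finset.prod_mul_distrib]
    refine Finset.prod_congr rfl fun i _ => Finset.prod_congr rfl fun j _ => ?_
    split_ifs
    · rw [map_add, β.map_add_right]
    · rw [one_mul]
  refine ⟨⟨ξ, fun a b c => ?_⟩, fun a b => ?_⟩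
  · rw [hl, hr, mul_comm (ξ b c), mul_assoc]
  · change β a b = ξ a b * (ξ b a)⁻¹
    -- By skew-symmetry the inverse of the transpose supplies the other half, i > j.
    have h1 : (ξ b a)⁻¹ = ∏ i, ∏ j, if o j < o i then β (π i a) (π j b) else 1 := by
      simp only [ξ]
      rw [Finset.prod_comm]
      simp only [← Finset.prod_inv_distrib]
      refine Finset.prod_congr rfl fun i _ => Finset.prod_congr rfl fun j _ => ?_
      split_ifs
      · rw [β.inv_apply]
      · rw [inv_one]
    rw [h1]
    simp only [ξ, ← Finset.prod_mul_distrib]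
    conv_lhs => rw [← hsum a, ← hsum b, β.map_sum_left]
    refine Finset.prod_congr rfl fun i _ => ?_
    rw [β.map_sum_right]
    refine Finset.prod_congr rfl fun j _ => ?_
    rcases lt_trichotomy (o i) (o j) with h | h | h
    · rw [if_pos h, if_neg h.not_gt, mul_one]
    · obtain rfl := o.injective h
      rw [hdiag, if_neg (lt_irrefl _), one_mul]
    · rw [if_pos h, if_neg h.not_gt, one_mul]

end CocycleExistence

/-! ### Associative forms and decomposition into simple ideals. -/

section InvariantForm

variable {F J : Type*} [Field F] [NonUnitalNonAssocRing J] [Module F J]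
  {B : LinearMap.BilinForm F J}

theorem IsIdeal.orthogonal (hsymm : ∀ x y, B x y = B y x)
    (hassoc : ∀ x y z, B (x * y) z = B x (y * z)) {I : Submodule F J} (hI : IsIdeal I) :
    IsIdeal (B.orthogonal I) := by
  intro a x hx
  rw [LinearMap.BilinForm.mem_orthogonal_iff] at hx
  refine ⟨fun y hy => ?_, fun y hy => ?_⟩
  · change B y (a * x) = 0
    rw [← hassoc]
    exact hx _ (hI a y hy).2
  · change B y (x * a) = 0
    rw [hsymm, hassoc, hsymm]
    exact hx _ (hI a y hy).1

/-- An ideal with zero multiplication lies in the nil radical. -/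
theorem IsIdeal.le_nilRadical {I : Submodule F J} (hI : IsIdeal I)
    (h : ∀ x ∈ I, ∀ y ∈ I, x * y = 0) : I ≤ nilRadical F J :=
  le_sSup ⟨hI, fun x hx => ⟨1, h x hx x hx⟩⟩

/-- In an algebra without nil ideals, an ideal is complemented by its orthogonal with respect to
a nondegenerate associative form. -/
theorem IsIdeal.isCompl_orthogonal [FiniteDimensional F J] (hB : B.Nondegenerate)
    (hsymm : ∀ x y, B x y = B y x) (hassoc : ∀ x y z, B (x * y) z = B x (y * z))
    (hnil : nilRadical F J = ⊥) {I : Submodule F J} (hI : IsIdeal I) :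
    IsCompl I (B.orthogonal I) := by
  have hrefl : B.IsRefl := fun x y h => by rw [hsymm, h]
  rw [LinearMap.BilinForm.isCompl_orthogonal_iff_disjoint hrefl, disjoint_iff, ← le_bot_iff, ← hnil]
  have hO := hI.orthogonal hsymm hassoc
  -- The ideal I ∩ I^⊥ has zero multiplication: B(xy, z) = B(x, yz) = 0 for every z, as yz ∈ I and x
  -- ∈ I^⊥.
  refine IsIdeal.le_nilRadical (fun a x hx => ⟨⟨(hI a x hx.1).1, (hO a x hx.2).1⟩,
    ⟨(hI a x hx.1).2, (hO a x hx.2).2⟩⟩) fun x hx y hy => hB.1 _ fun z => ?_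
  rw [hassoc, hsymm]
  exact hx.2 _ (hI z y hy.1).2

variable [IsScalarTower F J J] [SMulCommClass F J J]

variable (F J) in
/-- The multiplication algebra, generated by all left and right multiplications. -/
abbrev multiplicationAlgebra : Subalgebra F (Module.End F J) :=
  Algebra.adjoin F (Set.range (LinearMap.mulLeft F : J → Module.End F J) ∪
    Set.range (LinearMap.mulRight F : J → Module.End F J))

/-- An ideal as a submodule over the multiplication algebra. -/
def IsIdeal.toSubmodule {I : Submodule F J} (hI : IsIdeal I) :
    Submodule (multiplicationAlgebra F J) J :=
  { I with
    smul_mem' := by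
      rintro ⟨c, hc⟩ x hx
      change c x ∈ I
      induction hc using Algebra.adjoin_induction generalizing x with
      | mem c hc =>
        rcases hc with ⟨a, rfl⟩ | ⟨a, rfl⟩
        · exact (hI a x hx).1
        · exact (hI a x hx).2
      | algebraMap r => exact I.smul_mem r hx
      | add c d _ _ hc hd => exact I.add_mem (hc hx) (hd hx)
      | mul c d _ _ hc hd => exact hc (hd hx) }

theorem isIdeal_restrictScalars (N : Submodule (multiplicationAlgebra F J) J) :
    IsIdeal (N.restrictScalars F) := fun a _ hx =>
  ⟨N.smul_mem ⟨LinearMap.mulLeft F a, Algebra.subset_adjoin (Or.inl ⟨a, rfl⟩)⟩ hx,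
    N.smul_mem ⟨LinearMap.mulRight F a, Algebra.subset_adjoin (Or.inr ⟨a, rfl⟩)⟩ hx⟩

/-- **Dieudonné's theorem**: a finite-dimensional algebra without nil ideals and with a
nondegenerate associative symmetric form is a direct sum of simple ideals. -/
theorem isDirectSumOfSimpleIdeals_of_form [FiniteDimensional F J] (hB : B.Nondegenerate)
    (hsymm : ∀ x y, B x y = B y x) (hassoc : ∀ x y z, B (x * y) z = B x (y * z))
    (hnil : nilRadical F J = ⊥) : IsDirectSumOfSimpleIdeals F J := by
  have hcompl {I : Submodule F J} (hI : IsIdeal I) : IsCompl I (B.orthogonal I) :=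
    hI.isCompl_orthogonal hB hsymm hassoc hnil
  -- Ideals are the submodules over the multiplication algebra, so orthogonal complements give
  -- complete reducibility.
  have : IsSemisimpleModule (multiplicationAlgebra F J) J :=
    { exists_isCompl := fun N => by
        have hN := isIdeal_restrictScalars N
        refine ⟨(hN.orthogonal hsymm hassoc).toSubmodule, ?_⟩
        have h := hcompl hN
        rw [isCompl_iff, Submodule.disjoint_def, Submodule.codisjoint_iff_exists_add_eq] at h ⊢
        exact h }
  have hsimple (N : Submodule (multiplicationAlgebra F J) J)
      (hN : IsSimpleModule (multiplicationAlgebra F J) N) :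
      IsSimpleIdeal (N.restrictScalars F) := by
    rw [isSimpleModule_iff_isAtom] at hN
    have hI := isIdeal_restrictScalars N
    refine ⟨hI, ?_, fun K hK hKI => ?_⟩
    · by_contra! h
      have h1 := hI.le_nilRadical h
      rw [hnil, le_bot_iff, Submodule.restrictScalars_eq_bot_iff] at h1
      exact hN.1 h1
    · have hO := hI.orthogonal hsymm hassoc
      -- An ideal of the algebra I is an ideal of J: write a = b + c with b ∈ I and c ∈ I^⊥;
      -- products of c with elements of I lie in I ∩ I^⊥ = 0.
      have hKJ : IsIdeal K := by
        intro a x hx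
        obtain ⟨b, c, hb, hc, rfl⟩ :=
          Submodule.codisjoint_iff_exists_add_eq.1 (hcompl hI).codisjoint a
        have h0 := Submodule.disjoint_def.1 (hcompl hI).disjoint
        rw [add_mul, mul_add, h0 (c * x) (hI c x (hK hx)).1 (hO x c hc).2,
          h0 (x * c) (hI c x (hK hx)).2 (hO x c hc).1, add_zero, add_zero]
        exact hKI b hb x hx
      have hle : hKJ.toSubmodule ≤ N := hK
      rcases hN.le_iff.1 hle with h | h
      · left
        ext x
        exact SetLike.ext_iff.1 h x
      · right
        ext x
        exact SetLike.ext_iff.1 h x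
  obtain ⟨s, hs, htop, hsimp⟩ :=
    IsSemisimpleModule.exists_sSupIndep_sSup_simples_eq_top (multiplicationAlgebra F J) J
  have : IsNoetherian (multiplicationAlgebra F J) J := isNoetherian_of_tower F inferInstance
  have hfin : Finite s := WellFoundedGT.finite_of_sSupIndep hs
  obtain ⟨n, ⟨σ⟩⟩ := Finite.exists_equiv_fin s
  refine ⟨n, fun i => (σ.symm i : Submodule (multiplicationAlgebra F J) J).restrictScalars F,
    fun i => hsimple _ (hsimp _ (σ.symm i).2), ?_⟩
  have h : DirectSum.IsInternal
      (fun i => (σ.symm i : Submodule (multiplicationAlgebra F J) J)) := by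
    refine DirectSum.isInternal_submodule_of_iSupIndep_of_iSup_eq_top ?_ ?_
    · exact ((sSupIndep_iff s).1 hs).comp σ.symm.injective
    · rw [σ.symm.iSup_comp (g := fun i : s => (i : Submodule (multiplicationAlgebra F J) J)),
        ← sSup_eq_iSup', htop]
  -- Internality only involves the underlying additive map, so it does not depend on the scalars.
  exact h

end InvariantForm

/-! ### The coefficient at `u_0` as a trace on the twisted group algebra. -/

theorem TwoCocycle.CorrespondsTo.apply_neg {F G : Type*} [Field F] [AddCommGroup G]
    {ξ : TwoCocycle F G} {β : AlternatingBicharacter F G} (hξ : ξ.CorrespondsTo β) (g : G) :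
    ξ g (-g) = ξ (-g) g := by
  have h := hξ g (-g)
  rw [β.map_self_neg] at h
  exact mul_inv_eq_one.1 h.symm

namespace TwistedGroupAlgebra

variable {F G : Type*} [Field F] [AddCommGroup G] (ξ : TwoCocycle F G)

theorem u_ne_zero (g : G) : u ξ g ≠ 0 := (basis ξ).ne_zero g

theorem coord_u [DecidableEq G] (g h : G) : (basis ξ).coord g (u ξ h) = if h = g then 1 else 0 := by
  rw [Module.Basis.coord_apply, u, Module.Basis.repr_self, Finsupp.single_apply]

/-- Pairing with `u_{-g}` recovers the coordinate at g up to a unit; this is the source of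
nondegeneracy. -/
theorem coord_mul_u_neg (x : TwistedGroupAlgebra ξ) (g : G) :
    (basis ξ).coord 0 (x * u ξ (-g)) = (basis ξ).coord g x * ξ g (-g) := by
  classical
  have h : (basis ξ).coord 0 ∘ₗ LinearMap.mulRight F (u ξ (-g)) =
      (ξ g (-g) : F) • (basis ξ).coord g := by
    refine (basis ξ).ext fun a => ?_
    change (basis ξ).coord 0 (u ξ a * u ξ (-g)) = (ξ g (-g) : F) • (basis ξ).coord g (u ξ a)
    rw [u_mul_u, map_smul, coord_u, coord_u]
    by_cases hag : a = g
    · subst hag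
      rw [add_neg_cancel]
      simp
    · rw [if_neg hag, if_neg (fun h => hag (add_neg_eq_zero.1 h)), smul_zero, smul_zero]
  rw [mul_comm]
  exact LinearMap.congr_fun h x

/-- The coefficient at `u_0` is a trace on the algebra. -/
theorem coord_zero_mul_comm {β : AlternatingBicharacter F G} (hξ : ξ.CorrespondsTo β)
    (x y : TwistedGroupAlgebra ξ) :
    (basis ξ).coord 0 (x * y) = (basis ξ).coord 0 (y * x) := by
  classical
  have h : (LinearMap.mul F (TwistedGroupAlgebra ξ)).compr₂ ((basis ξ).coord 0) =
      ((LinearMap.mul F (TwistedGroupAlgebra ξ)).compr₂ ((basis ξ).coord 0)).flip := by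
    refine (basis ξ).ext fun a => (basis ξ).ext fun b => ?_
    change (basis ξ).coord 0 (u ξ a * u ξ b) = (basis ξ).coord 0 (u ξ b * u ξ a)
    rw [u_mul_u, u_mul_u, map_smul, map_smul, coord_u, coord_u, add_comm b a]
    split_ifs with hab
    · rw [eq_neg_of_add_eq_zero_right hab, hξ.apply_neg]
    · rw [smul_zero, smul_zero]
  exact LinearMap.congr_fun (LinearMap.congr_fun h x) y

/-- Left multiplication by `u_a` shifts the basis lines by a, so only a = 0 has diagonal entries,
each equal to ξ(0,0). -/
theorem trace_mulLeft [Finite G] (x : TwistedGroupAlgebra ξ) :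
    LinearMap.trace F (TwistedGroupAlgebra ξ) (LinearMap.mulLeft F x) =
      Nat.card G * ξ 0 0 * (basis ξ).coord 0 x := by
  classical
  have := Fintype.ofFinite G
  have h : LinearMap.trace F (TwistedGroupAlgebra ξ) ∘ₗ LinearMap.mul F (TwistedGroupAlgebra ξ) =
      (Nat.card G * ξ 0 0 : F) • (basis ξ).coord 0 := by
    refine (basis ξ).ext fun a => ?_
    change LinearMap.trace F _ (LinearMap.mulLeft F (u ξ a)) =
      (Nat.card G * ξ 0 0 : F) • (basis ξ).coord 0 (u ξ a)
    have hb (b : G) : (basis ξ).coord b (u ξ a * u ξ b) = if a = 0 then (ξ 0 0 : F) else 0 := by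
      rw [u_mul_u, map_smul, coord_u, add_eq_right, smul_eq_mul, mul_ite, mul_one, mul_zero]
      split_ifs with ha
      · rw [ha, ξ.zero_left]
      · rfl
    rw [LinearMap.trace_eq_matrix_trace F (basis ξ), Matrix.trace]
    have hd (b : G) : (LinearMap.toMatrix (basis ξ) (basis ξ) (LinearMap.mulLeft F (u ξ a))).diag b =
        if a = 0 then (ξ 0 0 : F) else 0 := by
      rw [← hb b, Matrix.diag_apply, LinearMap.toMatrix_apply]
      rfl
    rw [Finset.sum_congr rfl fun b _ => hd b, coord_u, Finset.sum_const, Finset.card_univ,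
      Nat.card_eq_fintype_card, nsmul_eq_mul, smul_eq_mul, mul_ite, mul_ite]
    simp
  exact LinearMap.congr_fun h x

/-- A nilpotent left multiplication has trace zero, and the factor |G| ξ(0,0) is nonzero in
characteristic 0. -/
theorem coord_zero_eq_zero_of_isNilpotent [CharZero F] [Finite G] {x : TwistedGroupAlgebra ξ}
    (hx : IsNilpotent x) : (basis ξ).coord 0 x = 0 := by
  have : Module.Finite F (TwistedGroupAlgebra ξ) := Module.Finite.of_basis (basis ξ)
  have h : IsNilpotent (LinearMap.mulLeft F x) := hx.map (Algebra.lmul F (TwistedGroupAlgebra ξ))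
  have h1 := (LinearMap.isNilpotent_trace_of_isNilpotent h).eq_zero
  rw [trace_mulLeft] at h1
  refine (mul_eq_zero.1 h1).resolve_left (mul_ne_zero ?_ (Units.ne_zero _))
  exact_mod_cast Nat.card_pos.ne'

end TwistedGroupAlgebra

open TwistedGroupAlgebra

/-! ### The trace form and semisimplicity of J(R). -/

section JordanAlgebra

variable {F G : Type*} [Field F] [CharZero F] [AddCommGroup G] (ξ : TwoCocycle F G)
  {β : AlternatingBicharacter F G} (hξ : ξ.CorrespondsTo β) {R : Set G} (hR : IsJordanSystem β R)

instance : IsCommJordan (JordanAlgebra ξ hξ hR) where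
  lmul_comm_rmul_rmul x y := Subtype.ext (IsCommJordan.lmul_comm_rmul_rmul x.1 y.1)

/-- The inclusion of `J(R)` into the twisted group algebra. -/
def inclusion : JordanAlgebra ξ hξ hR →ₗ[F] TwistedGroupAlgebra ξ where
  toFun x := SymAlg.unsym x.1
  map_add' _ _ := rfl
  map_smul' _ _ := rfl

theorem inclusion_injective : Function.Injective (inclusion ξ hξ hR) :=
  SymAlg.unsym_injective.comp Subtype.val_injective

theorem inclusion_uJ {g : G} (hg : g ∈ R) : inclusion ξ hξ hR (uJ ξ hξ hR hg) = u ξ g := rfl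

theorem two_smul_inclusion_mul (x y : JordanAlgebra ξ hξ hR) :
    (2 : F) • inclusion ξ hξ hR (x * y) =
      inclusion ξ hξ hR x * inclusion ξ hξ hR y + inclusion ξ hξ hR y * inclusion ξ hξ hR x := by
  change (2 : F) • (⅟2 * (inclusion ξ hξ hR x * inclusion ξ hξ hR y +
    inclusion ξ hξ hR y * inclusion ξ hξ hR x)) = _
  rw [Algebra.smul_def, map_ofNat, mul_invOf_cancel_left]

-- Symmetrization does nothing to commuting elements; this carries powers and inverses between the
-- two products.
variable {ξ hξ hR} in
theorem inclusion_mul_of_commute {x y : JordanAlgebra ξ hξ hR}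
    (h : Commute (inclusion ξ hξ hR x) (inclusion ξ hξ hR y)) :
    inclusion ξ hξ hR (x * y) = inclusion ξ hξ hR x * inclusion ξ hξ hR y := by
  have h1 := two_smul_inclusion_mul ξ hξ hR x y
  rw [← h.eq, ← two_smul F] at h1
  exact smul_right_injective _ (two_ne_zero (α := F)) h1

variable {ξ hξ hR} in
theorem isNilpotent_inclusion {x : JordanAlgebra ξ hξ hR} (hx : IsNilElement x) :
    IsNilpotent (inclusion ξ hξ hR x) := by
  obtain ⟨n, hn⟩ := hx
  have h (k : ℕ) : inclusion ξ hξ hR ((fun y => x * y)^[k] x) = inclusion ξ hξ hR x ^ (k + 1) := by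
    induction k with
    | zero => rw [Function.iterate_zero, id, zero_add, pow_one]
    | succ k ih =>
      rw [Function.iterate_succ_apply', inclusion_mul_of_commute, ih, pow_succ' _ (k + 1)]
      rw [ih]
      exact Commute.self_pow _ _
  -- The iteration starts at x, so n steps give the power n + 1.
  exact ⟨n + 1, by rw [← h, hn, map_zero]⟩

/-- A trace takes the same value on xy and yx, so it cannot see the symmetrization. -/
theorem coord_zero_inclusion_mul (x y : JordanAlgebra ξ hξ hR) :
    (basis ξ).coord 0 (inclusion ξ hξ hR (x * y)) =
      (basis ξ).coord 0 (inclusion ξ hξ hR x * inclusion ξ hξ hR y) := by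
  have h := congrArg ((basis ξ).coord 0) (two_smul_inclusion_mul ξ hξ hR x y)
  rw [map_add, coord_zero_mul_comm ξ hξ (inclusion ξ hξ hR y), map_smul, ← two_smul F] at h
  exact smul_right_injective _ (two_ne_zero (α := F)) h

/-- The basis `(u_g)`, `g ∈ R`, of `J(R)`. -/
noncomputable def jordanBasis : Module.Basis R F (JordanAlgebra ξ hξ hR) :=
  Module.Basis.mk (v := fun g : R => uJ ξ hξ hR g.2)
    (LinearIndependent.of_comp (inclusion ξ hξ hR)
      ((basis ξ).linearIndependent.comp _ Subtype.val_injective)) (by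
    rintro ⟨x, hx⟩ -
    have h : (Submodule.span F (Set.range fun g : R => uJ ξ hξ hR g.2)).map
        (jordanSubalgebra ξ hξ hR).toSubmodule.subtype =
        Submodule.span F ((fun a => SymAlg.sym (u ξ a)) '' R) := by
      rw [Submodule.map_span, ← Set.range_comp, Set.image_eq_range]
      rfl
    have hx' : x ∈ Submodule.span F ((fun a => SymAlg.sym (u ξ a)) '' R) := hx
    rw [← h] at hx'
    obtain ⟨y, hy, rfl⟩ := hx'
    exact hy)

theorem jordanBasis_apply (g : R) : jordanBasis ξ hξ hR g = uJ ξ hξ hR g.2 :=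
  Module.Basis.mk_apply _ _ g

theorem jordanBasis_coord (g : R) (x : JordanAlgebra ξ hξ hR) :
    (jordanBasis ξ hξ hR).coord g x = (basis ξ).coord g (inclusion ξ hξ hR x) := by
  classical
  have h : (jordanBasis ξ hξ hR).coord g = (basis ξ).coord g ∘ₗ inclusion ξ hξ hR := by
    refine (jordanBasis ξ hξ hR).ext fun a => ?_
    rw [Module.Basis.coord_apply, Module.Basis.repr_self, Finsupp.single_apply,
      LinearMap.comp_apply, jordanBasis_apply, inclusion_uJ, coord_u]
    simp only [Subtype.ext_iff]
  rw [h, LinearMap.comp_apply]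

theorem finiteDimensional_jordanAlgebra [Finite G] :
    FiniteDimensional F (JordanAlgebra ξ hξ hR) :=
  Module.Finite.of_basis (jordanBasis ξ hξ hR)

theorem trace_mul_jordanAlgebra [Finite G] (x : JordanAlgebra ξ hξ hR) :
    LinearMap.trace F (JordanAlgebra ξ hξ hR) (LinearMap.mul F (JordanAlgebra ξ hξ hR) x) =
      Nat.card R * ξ 0 0 * (basis ξ).coord 0 (inclusion ξ hξ hR x) := by
  classical
  have := Fintype.ofFinite R
  have h : LinearMap.trace F (JordanAlgebra ξ hξ hR) ∘ₗ LinearMap.mul F (JordanAlgebra ξ hξ hR) =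
      (Nat.card R * ξ 0 0 : F) • ((basis ξ).coord 0 ∘ₗ inclusion ξ hξ hR) := by
    refine (jordanBasis ξ hξ hR).ext fun a => ?_
    have hb (b : R) : (jordanBasis ξ hξ hR).coord b (uJ ξ hξ hR a.2 * uJ ξ hξ hR b.2) =
        if (a : G) = 0 then (ξ 0 0 : F) else 0 := by
      refine smul_right_injective _ (two_ne_zero (α := F)) ?_
      change (2 : F) • _ = (2 : F) • _
      rw [jordanBasis_coord, ← map_smul, two_smul_inclusion_mul, inclusion_uJ, inclusion_uJ,
        u_mul_u, u_mul_u, map_add, map_smul, map_smul, coord_u, coord_u, add_eq_right, add_eq_left]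
      split_ifs with ha
      · rw [ha, ξ.zero_left, ξ.zero_right (b : G), ← two_smul F, smul_eq_mul _ (1 : F), mul_one]
      · simp
    rw [LinearMap.comp_apply, jordanBasis_apply,
      LinearMap.trace_eq_matrix_trace F (jordanBasis ξ hξ hR), Matrix.trace]
    have hd (b : R) : (LinearMap.toMatrix (jordanBasis ξ hξ hR) (jordanBasis ξ hξ hR)
        (LinearMap.mul F (JordanAlgebra ξ hξ hR) (uJ ξ hξ hR a.2))).diag b =
        if (a : G) = 0 then (ξ 0 0 : F) else 0 := by
      rw [← hb b, Matrix.diag_apply, LinearMap.toMatrix_apply, jordanBasis_apply]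
      rfl
    rw [Finset.sum_congr rfl fun b _ => hd b, Finset.sum_const, Finset.card_univ,
      Nat.card_eq_fintype_card, nsmul_eq_mul, LinearMap.smul_apply, LinearMap.comp_apply,
      inclusion_uJ, coord_u, smul_eq_mul, mul_ite, mul_ite]
    simp
  exact LinearMap.congr_fun h x

theorem traceForm_apply [Finite G] (x y : JordanAlgebra ξ hξ hR) :
    traceForm F (JordanAlgebra ξ hξ hR) x y =
      Nat.card R * ξ 0 0 * (basis ξ).coord 0 (inclusion ξ hξ hR x * inclusion ξ hξ hR y) := by
  rw [← coord_zero_inclusion_mul]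
  exact trace_mul_jordanAlgebra ξ hξ hR (x * y)

theorem traceForm_symm [Finite G] (x y : JordanAlgebra ξ hξ hR) :
    traceForm F (JordanAlgebra ξ hξ hR) x y = traceForm F (JordanAlgebra ξ hξ hR) y x := by
  rw [traceForm_apply, traceForm_apply, coord_zero_mul_comm ξ hξ]

theorem traceForm_assoc [Finite G] (x y z : JordanAlgebra ξ hξ hR) :
    traceForm F (JordanAlgebra ξ hξ hR) (x * y) z =
      traceForm F (JordanAlgebra ξ hξ hR) x (y * z) := by
  rw [traceForm_apply, traceForm_apply]
  congr 1
  refine smul_right_injective _ (two_ne_zero (α := F)) ?_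
  change (2 : F) • _ = (2 : F) • _
  -- After doubling, the claim is t(xyz) + t(yxz) = t(xyz) + t(xzy), which holds by cyclicity of t.
  rw [← map_smul, ← map_smul, ← smul_mul_assoc, ← mul_smul_comm, two_smul_inclusion_mul,
    two_smul_inclusion_mul, add_mul, mul_add, map_add, map_add, mul_assoc, ← mul_assoc _ _
    (inclusion ξ hξ hR y), coord_zero_mul_comm ξ hξ (_ * _) (inclusion ξ hξ hR y), mul_assoc]

theorem natCard_mul_ne_zero [Finite G] (hR : R.Nonempty) : (Nat.card R * ξ 0 0 : F) ≠ 0 := by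
  have := hR.to_subtype
  refine mul_ne_zero ?_ (Units.ne_zero _)
  exact_mod_cast Nat.card_pos.ne'

theorem traceForm_nondegenerate [Finite G] :
    (traceForm F (JordanAlgebra ξ hξ hR)).Nondegenerate := by
  have h (x : JordanAlgebra ξ hξ hR)
      (hx : ∀ y, traceForm F (JordanAlgebra ξ hξ hR) x y = 0) : x = 0 := by
    refine (jordanBasis ξ hξ hR).ext_elem_iff.2 fun g => ?_
    have h1 := hx (uJ ξ hξ hR (hR.neg_mem g g.2))
    rw [traceForm_apply, inclusion_uJ, coord_mul_u_neg, ← jordanBasis_coord] at h1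
    rw [map_zero]
    exact (mul_eq_zero.1 ((mul_eq_zero.1 h1).resolve_left
      (natCard_mul_ne_zero ξ hR.nonempty))).resolve_right (Units.ne_zero _)
  exact ⟨h, fun x hx => h x fun y => by rw [traceForm_symm, hx]⟩

theorem nilRadical_jordanAlgebra [Finite G] : nilRadical F (JordanAlgebra ξ hξ hR) = ⊥ := by
  refine sSup_eq_bot.2 fun I hI => (Submodule.eq_bot_iff I).2 fun x hx =>
    (traceForm_nondegenerate ξ hξ hR).1 x fun y => ?_
  rw [traceForm_apply, ← coord_zero_inclusion_mul, coord_zero_eq_zero_of_isNilpotent, mul_zero]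
  -- The product of x and y stays in the nil ideal, so t kills it.
  exact isNilpotent_inclusion (hI.2 _ (hI.1 y x hx).2)

theorem isDirectSumOfSimpleIdeals_jordanAlgebra [Finite G] :
    IsDirectSumOfSimpleIdeals F (JordanAlgebra ξ hξ hR) :=
  have := finiteDimensional_jordanAlgebra ξ hξ hR
  isDirectSumOfSimpleIdeals_of_form (traceForm_nondegenerate ξ hξ hR) (traceForm_symm ξ hξ hR)
    (traceForm_assoc ξ hξ hR) (nilRadical_jordanAlgebra ξ hξ hR)

/-! ### The grading and invertibility of homogeneous elements. -/

theorem component_of_mem {g : G} (hg : g ∈ R) :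
    component ξ hξ hR g = Submodule.span F {uJ ξ hξ hR hg} := by
  ext x
  simp only [component, Submodule.mem_comap, Submodule.mem_span_singleton]
  exact exists_congr fun c => (Subtype.ext_iff (a1 := c • uJ ξ hξ hR hg) (a2 := x)).symm

theorem component_of_notMem {g : G} (hg : g ∉ R) : component ξ hξ hR g = ⊥ := by
  classical
  refine (Submodule.eq_bot_iff _).2 fun x hx => (jordanBasis ξ hξ hR).ext_elem_iff.2 fun h => ?_
  obtain ⟨c, hc⟩ := Submodule.mem_span_singleton.1 hx
  have hx' : inclusion ξ hξ hR x = c • u ξ g := congrArg SymAlg.unsym hc.symm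
  rw [map_zero]
  change (jordanBasis ξ hξ hR).coord h x = 0
  rw [jordanBasis_coord, hx', map_smul, coord_u, if_neg, smul_zero]
  rintro rfl
  exact hg h.2

theorem uJ_ne_zero {g : G} (hg : g ∈ R) : uJ ξ hξ hR hg ≠ 0 := fun h =>
  u_ne_zero ξ g (by rw [← inclusion_uJ ξ hξ hR hg, h, map_zero])

theorem component_ne_bot_iff {g : G} : component ξ hξ hR g ≠ ⊥ ↔ g ∈ R := by
  refine ⟨fun h => by_contra fun hg => h (component_of_notMem ξ hξ hR hg), fun hg => ?_⟩
  rw [component_of_mem ξ hξ hR hg, Ne, Submodule.span_singleton_eq_bot]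
  exact uJ_ne_zero ξ hξ hR hg

theorem support_component : {g | component ξ hξ hR g ≠ ⊥} = R :=
  Set.ext fun _ => component_ne_bot_iff ξ hξ hR

theorem iSup_component : ⨆ g, component ξ hξ hR g = ⊤ := by
  rw [eq_top_iff, ← (jordanBasis ξ hξ hR).span_eq, Submodule.span_le]
  rintro _ ⟨g, rfl⟩
  refine Submodule.mem_iSup_of_mem (g : G) ?_
  rw [component_of_mem ξ hξ hR g.2, jordanBasis_apply]
  exact Submodule.mem_span_singleton_self _

theorem iSupIndep_component : iSupIndep (component ξ hξ hR) := by
  intro g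
  rw [Submodule.disjoint_def]
  intro x hx hx'
  have h (k : G) : component ξ hξ hR k ≤
      (Submodule.span F {u ξ k}).comap (inclusion ξ hξ hR) := by
    intro y hy
    obtain ⟨c, hc⟩ := Submodule.mem_span_singleton.1 hy
    exact Submodule.mem_span_singleton.2 ⟨c, congrArg SymAlg.unsym hc⟩
  have h1 : (⨆ k, ⨆ (_ : k ≠ g), component ξ hξ hR k) ≤
      (⨆ k, ⨆ (_ : k ≠ g), Submodule.span F {u ξ k}).comap (inclusion ξ hξ hR) :=
    iSup₂_le fun k hk => (h k).trans (Submodule.comap_mono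
      (le_iSup₂ (f := fun (k : G) (_ : k ≠ g) => Submodule.span F {u ξ k}) k hk))
  have h2 := Submodule.disjoint_def.1
    ((basis ξ).linearIndependent.iSupIndep_span_singleton g) _ (h g hx) (h1 hx')
  exact inclusion_injective ξ hξ hR (h2.trans (map_zero _).symm)

theorem isGrading_component : IsGrading (component ξ hξ hR) where
  internal := by
    classical
    exact DirectSum.isInternal_submodule_of_iSupIndep_of_iSup_eq_top
      (iSupIndep_component ξ hξ hR) (iSup_component ξ hξ hR)
  mul_mem g h x hx y hy := by
    obtain ⟨c, hc⟩ := Submodule.mem_span_singleton.1 hx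
    obtain ⟨d, hd⟩ := Submodule.mem_span_singleton.1 hy
    -- No case split on g + h ∈ R is needed: the product already lies in J(R), and components are
    -- defined by lines in the ambient algebra.
    refine Submodule.mem_span_singleton.2 ⟨d * (c * ((2 : F)⁻¹ * (ξ g h + ξ h g))), ?_⟩
    change _ = x.1 * y.1
    change _ = x.1 at hc
    change _ = y.1 at hd
    rw [← hc, ← hd, smul_mul_assoc, mul_smul_comm, sym_u_mul_sym_u, smul_smul, smul_smul]
    ring_nf
  support_generates := by
    rw [support_component]
    exact hR.generates

theorem isMultiplicityFree_component : IsMultiplicityFree (component ξ hξ hR) := by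
  intro g hg
  rw [component_ne_bot_iff] at hg
  rw [component_of_mem ξ hξ hR hg]
  exact finrank_span_singleton (uJ_ne_zero ξ hξ hR hg)

theorem inclusion_one : inclusion ξ hξ hR 1 = 1 := rfl

theorem isJordanInvertible_smul_uJ {g : G} (hg : g ∈ R) {c : F} (hc : c ≠ 0) :
    IsJordanInvertible (c • uJ ξ hξ hR hg) := by
  set x := c • uJ ξ hξ hR hg with hx
  -- The associative inverse of x, because `u_g u_{-g}` = ξ(g,-g) `u_0` and `u_0` = ξ(0,0) · 1.
  set y := (c⁻¹ * (ξ g (-g) * ξ 0 0 : F)⁻¹) • uJ ξ hξ hR (hR.neg_mem g hg) with hy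
  have hxi : inclusion ξ hξ hR x = c • u ξ g := by rw [hx, map_smul, inclusion_uJ]
  have hyi : inclusion ξ hξ hR y = (c⁻¹ * (ξ g (-g) * ξ 0 0 : F)⁻¹) • u ξ (-g) := by
    rw [hy, map_smul, inclusion_uJ]
  have hscal : c * (c⁻¹ * (ξ g (-g) * ξ 0 0 : F)⁻¹) * ξ g (-g) = (ξ 0 0 : F)⁻¹ := by
    have h1 := (ξ g (-g)).ne_zero
    have h2 := (ξ 0 0).ne_zero
    field_simp
  have hxy : inclusion ξ hξ hR x * inclusion ξ hξ hR y = 1 := by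
    rw [hxi, hyi, smul_mul_smul_comm, u_mul_u, smul_smul, hscal, add_neg_cancel]
    rfl
  have hyx : inclusion ξ hξ hR y * inclusion ξ hξ hR x = 1 := by
    rw [hxi, hyi, smul_mul_smul_comm, u_mul_u, smul_smul, mul_comm (_ * _) c,
      ← hξ.apply_neg, hscal, neg_add_cancel]
    rfl
  have hcomm : Commute (inclusion ξ hξ hR x) (inclusion ξ hξ hR y) := hxy.trans hyx.symm
  have hxx := inclusion_mul_of_commute (Commute.refl (inclusion ξ hξ hR x))
  refine ⟨y, inclusion_injective ξ hξ hR ?_, inclusion_injective ξ hξ hR ?_⟩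
  · rw [inclusion_mul_of_commute hcomm, hxy, inclusion_one]
  · rw [inclusion_mul_of_commute (by rw [hxx]; exact hcomm.mul_left hcomm), hxx, mul_assoc, hxy,
      mul_one]

theorem isDivisionGrading_component : IsDivisionGrading (component ξ hξ hR) := by
  intro g x hx h0
  have hg : g ∈ R := (component_ne_bot_iff ξ hξ hR).1 fun h => h0 (by simpa [h] using hx)
  rw [component_of_mem ξ hξ hR hg] at hx
  obtain ⟨c, rfl⟩ := Submodule.mem_span_singleton.1 hx
  exact isJordanInvertible_smul_uJ ξ hξ hR hg fun hc => h0 (by rw [hc, zero_smul])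

theorem isJordanInvertible_uJ {g : G} (hg : g ∈ R) :
    IsJordanInvertible (uJ ξ hξ hR hg) := by
  rw [← one_smul F (uJ ξ hξ hR hg)]
  exact isJordanInvertible_smul_uJ ξ hξ hR hg one_ne_zero

end JordanAlgebra

end SkewRoot

theorem mainTheorem3 {F G : Type*} [Field F] [IsAlgClosed F] [CharZero F] [AddCommGroup G]
    [Finite G] (β : SkewRoot.AlternatingBicharacter F G) (R : Set G)
    (hR : SkewRoot.IsJordanSystem β R) :
    (∃ ξ : SkewRoot.TwoCocycle F G, ξ.CorrespondsTo β) ∧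
    ∀ (ξ : SkewRoot.TwoCocycle F G) (hξ : ξ.CorrespondsTo β),
      -- `J(R)` is a Jordan algebra
      IsCommJordan (SkewRoot.JordanAlgebra ξ hξ hR) ∧
      -- its trace form is nondegenerate
      (SkewRoot.traceForm F (SkewRoot.JordanAlgebra ξ hξ hR)).Nondegenerate ∧
      -- it is semisimple
      SkewRoot.IsSemisimple F (SkewRoot.JordanAlgebra ξ hξ hR) ∧
      SkewRoot.IsDirectSumOfSimpleIdeals F (SkewRoot.JordanAlgebra ξ hξ hR) ∧
      -- the components `F u_g` (`g ∈ R`) form a multiplicity free division grading with support `R`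
      SkewRoot.IsGrading (SkewRoot.component ξ hξ hR) ∧
      {g | SkewRoot.component ξ hξ hR g ≠ ⊥} = R ∧
      (∀ (g : G) (hg : g ∈ R),
        SkewRoot.component ξ hξ hR g = Submodule.span F {SkewRoot.uJ ξ hξ hR hg}) ∧
      SkewRoot.IsMultiplicityFree (SkewRoot.component ξ hξ hR) ∧
      SkewRoot.IsDivisionGrading (SkewRoot.component ξ hξ hR) ∧
      -- each `u_g` is invertible
      ∀ (g : G) (hg : g ∈ R), SkewRoot.IsJordanInvertible (SkewRoot.uJ ξ hξ hR hg) := by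
  open SkewRoot in
  exact ⟨exists_twoCocycle_correspondsTo β, fun ξ hξ =>
    ⟨inferInstance, traceForm_nondegenerate ξ hξ hR,
      ⟨finiteDimensional_jordanAlgebra ξ hξ hR, nilRadical_jordanAlgebra ξ hξ hR⟩,
      isDirectSumOfSimpleIdeals_jordanAlgebra ξ hξ hR, isGrading_component ξ hξ hR,
      support_component ξ hξ hR, fun _ hg => component_of_mem ξ hξ hR hg,
      isMultiplicityFree_component ξ hξ hR, isDivisionGrading_component ξ hξ hR,
      fun _ hg => isJordanInvertible_uJ ξ hξ hR hg⟩⟩
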